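/- **Universal property of the enveloping C*-algebra.** *Setting.* A *normed $*$-algebra* is a complex (associative, not necessarily unital) algebra $A$ with an involution $a\mapsto a^*$ (conjugate-linear, anti-multiplicative, $a^{**}=a$) and a norm satisfying $|ab|\le|a||b|$; neither completeness nor continuity of the involution is assumed. Let $A_{sa}=\{a\in A: a^*=a\}$, a real normed space. Put $r_\lambda(a)=\inf_{n\ge1}|a^n|^{1/n}$ and $r_\sigma(a)=r_\lambda(a^*a)^{1/2}$. A linear map $f$ from $A$ to a normed space is *$\sigma$-contractive* if $\|f(a)\|\le r_\sigma(a)$ for all $a\in A$. A *representation* of $A$ in a complex Hilbert space $H$ is an algebra homomorphism $\pi:A\to\mathrm{End}(H)$ with $\langle\pi(a)x,y\rangle=\langle x,\pi(a^*)y\rangle$ for all $a\in A$ and $x,y\in H$ (all $\pi(a)$ are then bounded operators). A linear functional $\varphi$ on $A$ is *positive* if $\varphi(a^*a)\ge0$ for all $a$. It has *finite variation* if there is $v\ge0$ with $|\varphi(a)|^2\le v\,\varphi(a^*a)$ for all $a$; the least such $v$ is its variation $v(\varphi)$. A positive $\varphi$ is *weakly continuous on $A_{sa}$* if for every $b\in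 A$ the map $a\mapsto\varphi(b^*ab)$ is continuous on $A_{sa}$. A *quasi-state* (resp. *state*) on $A$ is a positive linear functional of finite variation, weakly continuous on $A_{sa}$, with $v(\varphi)\le1$ (resp. $v(\varphi)=1$). The set $QS(A)$ of quasi-states is regarded, by restriction to $A_{sa}$, as a subset of the dual of the real normed space $A_{sa}$, and carries the weak* topology; the set $S(A)\subset QS(A)$ of states carries the subspace topology. Put $\|a\|_o=\sup_{\psi\in S(A)}\psi(a^*a)^{1/2}$ ($:=0$ if $S(A)=\emptyset$). This is a finite seminorm, and the quotient of $A$ by the ideal $\{a:\|a\|_o=0\}$ with the norm induced by $\|\cdot\|_o$ is a $*$-algebra whose norm satisfies the C*-identity; its completion is the *enveloping C\*-algebra* $C^*(A)$, and $j:A\to C^*(A)$ denotes the canonical $*$-homomorphism. *Theorem.* Let $A$ be a normed $*$-algebra. 1. For every complex Hilbert space $H$, the assignment $\pi_o\mapsto\pi_o\circ j$ is a bijection from the set of all representations of $C^*(A)$ in $H$ onto the set of all $\sigma$-contractive representations of $A$ in $H$. 2. The assignment $\varphi_o\mapsto\varphi_o\circ j$ is a bijection from the set of all positive linear functionals on $C^*(A)$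 onto the set of all positive linear functionals of finite variation on $A$ that are weakly continuous on $A_{sa}$. Moreover, every positive linear functional $\varphi_o$ on $C^*(A)$ has finite variation, and $v(\varphi_o\circ j)=v(\varphi_o)$. 3. The sets $QS(C^*(A))$, $QS(A)$, $S(C^*(A))$ and $S(A)$ are convex, and the assignment $\varphi_o\mapsto\varphi_o\circ j$ is an affine homeomorphism from $QS(C^*(A))$ onto $QS(A)$, which restricts to an affine homeomorphism from $S(C^*(A))$ onto $S(A)$. -/

import Mathlib

open scoped ComplexOrder

universe u v

namespace EnvCStar

noncomputable section

section Functionals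

variable {A : Type u} [NonUnitalNormedRing A] [StarRing A] [NormedSpace ℂ A]

/-- Positivity of a linear functional: `φ (a⋆ a) ≥ 0` for all `a`
(in particular `φ (a⋆ a)` is real). -/
def IsPositive (φ : A →ₗ[ℂ] ℂ) : Prop := ∀ a : A, 0 ≤ φ (star a * a)

/-- For every `b`, the functional `a ↦ φ (b⋆ a b)` is continuous on the real subspace of
self-adjoint elements, with the topology of the norm of `A`. -/
def WeaklyContinuousOnSA (φ : A →ₗ[ℂ] ℂ) : Prop :=
  ∀ b : A, Continuous fun h : selfAdjoint A => φ (star b * (h : A) * b)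

/-- The constants `v ≥ 0` with `|φ a| ^ 2 ≤ v φ (a⋆ a)` for all `a`. -/
def variationBounds (φ : A →ₗ[ℂ] ℂ) : Set ℝ :=
  {v : ℝ | 0 ≤ v ∧ ∀ a : A, ‖φ a‖ ^ 2 ≤ v * (φ (star a * a)).re}

def HasFiniteVariation (φ : A →ₗ[ℂ] ℂ) : Prop := (variationBounds φ).Nonempty

/-- The variation of `φ` (meaningful if `φ` has finite variation). -/
def variation (φ : A →ₗ[ℂ] ℂ) : ℝ := sInf (variationBounds φ)

structure IsState (φ : A →ₗ[ℂ] ℂ) : Prop where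
  positive : IsPositive φ
  weaklyContinuous : WeaklyContinuousOnSA φ
  finiteVariation : HasFiniteVariation φ
  variation_eq_one : variation φ = 1

structure IsQuasiState (φ : A →ₗ[ℂ] ℂ) : Prop where
  positive : IsPositive φ
  weaklyContinuous : WeaklyContinuousOnSA φ
  finiteVariation : HasFiniteVariation φ
  variation_le_one : variation φ ≤ 1

variable (A) in
/-- The set `S(A)` of states, as a type. -/
def State : Type u := {φ : A →ₗ[ℂ] ℂ // IsState φ}

variable (A) in
/-- The set `QS(A)` of quasi-states, as a type. -/
def QuasiState : Type u := {φ : A →ₗ[ℂ] ℂ // IsQuasiState φ}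

/-- The Gelfand–Naimark seminorm `‖a‖ₒ = sup_ψ ψ (a⋆ a) ^ (1/2)` over all states `ψ`; it is `0` if
there are no states. The supremum is finite, see `bddAbove_gn`. -/
def gnSeminorm (a : A) : ℝ := ⨆ ψ : State A, √(ψ.1 (star a * a)).re

/-- `r_λ(a) = inf_{n ≥ 1} ‖a ^ n‖ ^ (1 / n)`; here `(a * ·)^[n] a = a ^ (n + 1)`. -/
def rLambda (a : A) : ℝ := ⨅ n : ℕ, ‖(fun x : A => a * x)^[n] a‖ ^ ((1 : ℝ) / (n + 1))

/-- The Pták function `r_σ(a) = r_λ(a⋆ a) ^ (1/2)`. -/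
def rSigma (a : A) : ℝ := √(rLambda (star a * a))

/-- A linear map `f` into a normed space with `‖f a‖ ≤ r_σ(a)` for all `a`. -/
def IsSigmaContractive {E : Type*} [NormedAddCommGroup E] [NormedSpace ℂ E] (f : A →ₗ[ℂ] E) :
    Prop := ∀ a : A, ‖f a‖ ≤ rSigma a

end Functionals

section Representations

/-- A representation of the `*`-algebra `A` in the pre-Hilbert space `H`. -/
structure StarRep (A : Type*) [NonUnitalNormedRing A] [StarRing A] [NormedSpace ℂ A]
    (H : Type*) [NormedAddCommGroup H] [InnerProductSpace ℂ H]
    extends A →ₙₐ[ℂ] Module.End ℂ H where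
  inner_left : ∀ (a : A) (x y : H), inner ℂ (toFun a x) y = inner ℂ x (toFun (star a) y)

variable {A : Type*} [NonUnitalNormedRing A] [StarRing A] [NormedSpace ℂ A]
  {B : Type*} [NonUnitalNormedRing B] [StarRing B] [NormedSpace ℂ B]
  {H : Type*} [NormedAddCommGroup H] [InnerProductSpace ℂ H]

/-- The representation `π ∘ f`. -/
def StarRep.comp (π : StarRep B H) (f : A →⋆ₙₐ[ℂ] B) : StarRep A H where
  toNonUnitalAlgHom := π.toNonUnitalAlgHom.comp f.toNonUnitalAlgHom
  inner_left a x y := by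
    have h := π.inner_left (f a) x y
    rw [← map_star] at h
    exact h

/-- Hellinger–Toeplitz: the operators of a representation in a Hilbert space are bounded. -/
theorem StarRep.continuous_apply [CompleteSpace H] (π : StarRep A H) (a : A) :
    Continuous (π.toFun a) := by
  refine (π.toFun a).continuous_of_seq_closed_graph fun u x y hu hy => ?_
  rw [← sub_eq_zero, ← inner_self_eq_zero (𝕜 := ℂ)]
  set z := y - π.toFun a x with hz
  have h1 : Filter.Tendsto (fun n => inner ℂ (π.toFun a (u n)) z) Filter.atTop
      (nhds (inner ℂ y z)) := Filter.Tendsto.inner hy tendsto_const_nhds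
  have h2 : Filter.Tendsto (fun n => inner ℂ (π.toFun a (u n)) z) Filter.atTop
      (nhds (inner ℂ (π.toFun a x) z)) := by
    simp only [π.inner_left]
    exact Filter.Tendsto.inner hu tendsto_const_nhds
  have h3 := tendsto_nhds_unique h1 h2
  rw [hz, inner_sub_left, ← hz, h3, sub_self]

/-- A representation in a Hilbert space as a linear map into the bounded operators. -/
def StarRep.op [CompleteSpace H] (π : StarRep A H) : A →ₗ[ℂ] (H →L[ℂ] H) where
  toFun a := ⟨π.toFun a, π.continuous_apply a⟩
  map_add' a b := by
    ext x
    exact congrArg (fun T : Module.End ℂ H => T x) (π.map_add' a b)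
  map_smul' c a := by
    ext x
    exact congrArg (fun T : Module.End ℂ H => T x) (π.map_smul' c a)

end Representations

set_option linter.unusedSectionVars false

section Seminorm

variable {A : Type u} [NonUnitalNormedRing A] [StarRing A] [NormedSpace ℂ A]

theorem mem_variationBounds {φ : A →ₗ[ℂ] ℂ} (hp : IsPositive φ) (hf : HasFiniteVariation φ) :
    variation φ ∈ variationBounds φ := by
  have h0 : 0 ≤ variation φ := Real.sInf_nonneg fun v hv => hv.1
  refine ⟨h0, fun a => ?_⟩
  have hre : 0 ≤ (φ (star a * a)).re := (Complex.le_def.1 (hp a)).1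
  rcases hre.eq_or_lt with h | h
  · obtain ⟨v, hv⟩ := hf
    have := hv.2 a
    rw [← h] at this ⊢
    simpa using this
  · rw [← div_le_iff₀ h]
    exact le_csInf hf fun v hv => (div_le_iff₀ h).2 (hv.2 a)

variable [IsScalarTower ℂ A A] [SMulCommClass ℂ A A] [StarModule ℂ A]

theorem form_symm {φ : A →ₗ[ℂ] ℂ} (hp : IsPositive φ) (a b : A) :
    (starRingEnd ℂ) (φ (star b * a)) = φ (star a * b) := by
  have h1 := (Complex.le_def.1 (hp (a + b))).2
  have h2 := (Complex.le_def.1 (hp (a + Complex.I • b))).2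
  have ha := (Complex.le_def.1 (hp a)).2
  have hb := (Complex.le_def.1 (hp b)).2
  simp only [star_add, star_smul, mul_add, add_mul, map_add, smul_mul_assoc, mul_smul_comm,
    map_smul, smul_eq_mul, Complex.add_im, Complex.mul_im, Complex.mul_re, Complex.zero_im,
    RCLike.star_def, Complex.conj_I, Complex.neg_re, Complex.neg_im, Complex.I_re,
    Complex.I_im] at h1 h2 ha hb
  apply Complex.ext
  · simp only [Complex.conj_re]; linarith
  · simp only [Complex.conj_im]; linarith

/-- The semi-inner product `(a, b) ↦ φ (a⋆ b)`. -/
@[reducible] def formCore {φ : A →ₗ[ℂ] ℂ} (hp : IsPositive φ) : PreInnerProductSpace.Core ℂ A where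
  inner a b := φ (star a * b)
  conj_inner_symm a b := form_symm hp a b
  re_inner_nonneg a := (Complex.le_def.1 (hp a)).1
  add_left a b c := by simp [add_mul]
  smul_left a b c := by
    rw [star_smul, smul_mul_assoc, map_smul]
    rfl

theorem form_cauchySchwarz {φ : A →ₗ[ℂ] ℂ} (hp : IsPositive φ) (a b : A) :
    ‖φ (star a * b)‖ ^ 2 ≤ (φ (star a * a)).re * (φ (star b * b)).re := by
  let _ := formCore hp
  have h := InnerProductSpace.Core.inner_mul_inner_self_le (𝕜 := ℂ) (F := A) a b
  have h' : ‖φ (star a * b)‖ * ‖φ (star b * a)‖ ≤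
    (φ (star a * a)).re * (φ (star b * b)).re := h
  have e : ‖φ (star b * a)‖ = ‖φ (star a * b)‖ := by
    rw [← form_symm hp a b, RCLike.norm_conj]
  rw [e] at h'
  rw [sq]; exact h'

theorem form_add_le {φ : A →ₗ[ℂ] ℂ} (hp : IsPositive φ) (a b : A) :
    √(φ (star (a + b) * (a + b))).re ≤ √(φ (star a * a)).re + √(φ (star b * b)).re := by
  have ha : 0 ≤ (φ (star a * a)).re := (Complex.le_def.1 (hp a)).1
  have hb : 0 ≤ (φ (star b * b)).re := (Complex.le_def.1 (hp b)).1
  apply Real.sqrt_le_iff.2 ⟨by positivity, ?_⟩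
  have h := form_cauchySchwarz hp a b
  have h1 : (φ (star a * b)).re ≤ √(φ (star a * a)).re * √(φ (star b * b)).re := by
    rw [← Real.sqrt_mul ha]
    exact (Complex.re_le_norm _).trans (Real.le_sqrt_of_sq_le h)
  have h2 : (φ (star b * a)).re = (φ (star a * b)).re := by
    rw [← form_symm hp a b, Complex.conj_re]
  rw [add_sq, Real.sq_sqrt ha, Real.sq_sqrt hb]
  simp only [star_add, mul_add, add_mul, map_add, Complex.add_re]
  linarith

/-- The functional `x ↦ φ (b⋆ x b)`. -/
def conjFunctional (φ : A →ₗ[ℂ] ℂ) (b : A) : A →ₗ[ℂ] ℂ where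
  toFun x := φ (star b * x * b)
  map_add' x y := by simp [mul_add, add_mul]
  map_smul' c x := by
    rw [mul_smul_comm, smul_mul_assoc, map_smul]
    rfl

theorem conjFunctional_positive {φ : A →ₗ[ℂ] ℂ} (hp : IsPositive φ) (b : A) :
    IsPositive (conjFunctional φ b) := fun a => by
  have := hp (a * b)
  simpa [conjFunctional, mul_assoc] using this

theorem conjFunctional_mem {φ : A →ₗ[ℂ] ℂ} (hp : IsPositive φ) (b : A) :
    (φ (star b * b)).re ∈ variationBounds (conjFunctional φ b) :=
  ⟨(Complex.le_def.1 (hp b)).1, fun a => by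
    have := form_cauchySchwarz hp b (a * b)
    simpa [conjFunctional, mul_assoc] using this⟩

theorem conjFunctional_weaklyContinuous {φ : A →ₗ[ℂ] ℂ} (hw : WeaklyContinuousOnSA φ) (b : A) :
    WeaklyContinuousOnSA (conjFunctional φ b) := fun c => by
  simpa [conjFunctional, mul_assoc] using hw (c * b)

/-- A functional of variation at most `v` that is continuous on `A_sa` is bounded by `v` there. -/
theorem norm_le_of_continuous {φ : A →ₗ[ℂ] ℂ} {v : ℝ} (hv : v ∈ variationBounds φ)
    (hc : Continuous fun h : selfAdjoint A => φ h) (h : A) (hh : IsSelfAdjoint h) :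
    ‖φ h‖ ≤ v * ‖h‖ := by
  let V := selfAdjoint.submodule ℝ A
  let F : V →L[ℝ] ℂ := ⟨(φ.restrictScalars ℝ).comp V.subtype, hc⟩
  have key : ∀ k : V, ‖F k‖ ≤ √(v * ‖F‖) * ‖k‖ := fun k => by
    have hk : star (k : A) = k := k.2
    let k2 : V := ⟨(k : A) * k, by
      show star ((k : A) * k) = k * k
      rw [star_mul, hk]⟩
    have h1 : ‖F k‖ ^ 2 ≤ v * (φ ((k : A) * k)).re := by
      have := hv.2 k
      rwa [hk] at this
    have h2 : (φ ((k : A) * k)).re ≤ ‖F‖ * (‖k‖ * ‖k‖) :=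
      (Complex.re_le_norm _).trans ((F.le_opNorm k2).trans
        (mul_le_mul_of_nonneg_left (norm_mul_le (k : A) k) (norm_nonneg _)))
    have h3 : ‖F k‖ ^ 2 ≤ (√(v * ‖F‖) * ‖k‖) ^ 2 := by
      rw [mul_pow, Real.sq_sqrt (mul_nonneg hv.1 (norm_nonneg F))]
      calc _ ≤ _ := h1
        _ ≤ v * (‖F‖ * (‖k‖ * ‖k‖)) := mul_le_mul_of_nonneg_left h2 hv.1
        _ = _ := by ring
    exact le_of_sq_le_sq h3 (by positivity)
  have h4 : ‖F‖ ≤ √(v * ‖F‖) := F.opNorm_le_bound (Real.sqrt_nonneg _) key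
  have h5 : ‖F‖ ≤ v := by
    rcases (norm_nonneg F).eq_or_lt with h0 | h0
    · rw [← h0]; exact hv.1
    · have := (Real.le_sqrt' h0).1 h4
      nlinarith
  exact (F.le_opNorm (⟨h, hh⟩ : V)).trans (mul_le_mul_of_nonneg_right h5 (norm_nonneg _))

theorem form_le_of_isSelfAdjoint {φ : A →ₗ[ℂ] ℂ} (hp : IsPositive φ)
    (hw : WeaklyContinuousOnSA φ) {v : ℝ} (hv : v ∈ variationBounds φ) (h : A)
    (hh : IsSelfAdjoint h) : (φ (h * h)).re ≤ v * (‖h‖ * ‖h‖) := by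
  have hs : star h = h := hh
  have hh2 : IsSelfAdjoint (h * h) := by
    show star (h * h) = h * h
    rw [star_mul, hs]
  have h1 := norm_le_of_continuous (conjFunctional_mem hp h) (hw h) (h * h) hh2
  have h2 := hv.2 (h * h)
  have e : star (h * h) * (h * h) = star h * (h * h) * h := by
    rw [star_mul, hs]; simp only [mul_assoc]
  have h3 : ((conjFunctional φ h) (h * h)).re ≤ _ := (Complex.re_le_norm _).trans h1
  have e' : (conjFunctional φ h) (h * h) = φ (star (h * h) * (h * h)) := by
    rw [e]; rfl
  rw [e', hs] at h3
  have hpos : 0 ≤ (φ (h * h)).re := by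
    have := (Complex.le_def.1 (hp h)).1
    rwa [hs] at this
  have h4 : (φ (h * h)).re ^ 2 ≤ v * ((φ (h * h)).re * (‖h‖ * ‖h‖)) := by
    calc (φ (h * h)).re ^ 2 ≤ ‖φ (h * h)‖ ^ 2 :=
          pow_le_pow_left₀ hpos (Complex.re_le_norm _) 2
      _ ≤ _ := h2
      _ ≤ _ := mul_le_mul_of_nonneg_left
        (h3.trans (mul_le_mul_of_nonneg_left (norm_mul_le h h) hpos)) hv.1
  rcases hpos.eq_or_lt with h0 | h0
  · rw [← h0]; have := hv.1; positivity
  · have : (φ (h * h)).re * (φ (h * h)).re ≤ (φ (h * h)).re * (v * (‖h‖ * ‖h‖)) := by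
      nlinarith
    exact le_of_mul_le_mul_left this h0

theorem norm_le_of_isSelfAdjoint {φ : A →ₗ[ℂ] ℂ} (hp : IsPositive φ)
    (hw : WeaklyContinuousOnSA φ) {v : ℝ} (hv : v ∈ variationBounds φ) (h : A)
    (hh : IsSelfAdjoint h) : ‖φ h‖ ≤ v * ‖h‖ := by
  have h1 := hv.2 h
  rw [show star h = h from hh] at h1
  have h2 := form_le_of_isSelfAdjoint hp hw hv h hh
  refine le_of_sq_le_sq ?_ (mul_nonneg hv.1 (norm_nonneg _))
  calc _ ≤ _ := h1
    _ ≤ v * (v * (‖h‖ * ‖h‖)) := mul_le_mul_of_nonneg_left h2 hv.1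
    _ = _ := by ring

theorem State.mem_variationBounds (ψ : State A) : 1 ∈ variationBounds ψ.1 := by
  have := EnvCStar.mem_variationBounds ψ.2.positive ψ.2.finiteVariation
  rwa [ψ.2.variation_eq_one] at this

theorem State.form_nonneg (ψ : State A) (a : A) : 0 ≤ (ψ.1 (star a * a)).re :=
  (Complex.le_def.1 (ψ.2.positive a)).1

theorem bddAbove_gn (a : A) :
    BddAbove (Set.range fun ψ : State A => √(ψ.1 (star a * a)).re) := by
  refine ⟨√‖star a * a‖, ?_⟩
  rintro _ ⟨ψ, rfl⟩
  apply Real.sqrt_le_sqrt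
  have := norm_le_of_isSelfAdjoint ψ.2.positive ψ.2.weaklyContinuous ψ.mem_variationBounds
    (star a * a) (IsSelfAdjoint.star_mul_self a)
  rw [one_mul] at this
  exact (Complex.re_le_norm _).trans this

theorem gn_nonneg (a : A) : 0 ≤ gnSeminorm a := Real.iSup_nonneg fun _ => Real.sqrt_nonneg _

theorem le_gn (ψ : State A) (a : A) : √(ψ.1 (star a * a)).re ≤ gnSeminorm a :=
  le_ciSup (bddAbove_gn a) ψ

theorem re_le_gn_sq (ψ : State A) (a : A) : (ψ.1 (star a * a)).re ≤ gnSeminorm a ^ 2 :=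
  (Real.sqrt_le_left (gn_nonneg a)).1 (le_gn ψ a)

theorem gn_le {a : A} {c : ℝ} (hc : 0 ≤ c)
    (h : ∀ ψ : State A, (ψ.1 (star a * a)).re ≤ c ^ 2) : gnSeminorm a ≤ c :=
  Real.iSup_le (fun ψ => (Real.sqrt_le_left hc).2 (h ψ)) hc

theorem gn_add_le (a b : A) : gnSeminorm (a + b) ≤ gnSeminorm a + gnSeminorm b :=
  Real.iSup_le (fun ψ => (form_add_le ψ.2.positive a b).trans
    (add_le_add (le_gn ψ a) (le_gn ψ b))) (add_nonneg (gn_nonneg a) (gn_nonneg b))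

theorem gn_smul (c : ℂ) (a : A) : gnSeminorm (c • a) = ‖c‖ * gnSeminorm a := by
  unfold gnSeminorm
  rw [Real.mul_iSup_of_nonneg (norm_nonneg c)]
  congr 1
  ext ψ
  have : (ψ.1 (star (c • a) * (c • a))).re = ‖c‖ ^ 2 * (ψ.1 (star a * a)).re := by
    rw [star_smul, smul_mul_assoc, mul_smul_comm, smul_smul, map_smul, RCLike.star_def,
      ← Complex.normSq_eq_conj_mul_self, smul_eq_mul, Complex.re_ofReal_mul, Complex.normSq_eq_norm_sq]
  rw [this, Real.sqrt_mul (by positivity), Real.sqrt_sq (norm_nonneg c)]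

theorem gn_zero : gnSeminorm (0 : A) = 0 := by simpa using gn_smul (0 : ℂ) (0 : A)

theorem gn_neg (a : A) : gnSeminorm (-a) = gnSeminorm a := by simpa using gn_smul (-1 : ℂ) a

/-- `φ (a⋆ a) ≤ v ‖a‖ₒ²` for `φ` weakly continuous on `A_sa` with variation bound `v`. -/
theorem form_le_gn {φ : A →ₗ[ℂ] ℂ} (hp : IsPositive φ) (hw : WeaklyContinuousOnSA φ) {v : ℝ}
    (hv : v ∈ variationBounds φ) (a : A) :
    (φ (star a * a)).re ≤ v * gnSeminorm a ^ 2 := by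
  have hf : HasFiniteVariation φ := ⟨v, hv⟩
  have hm := mem_variationBounds hp hf
  have hle : variation φ ≤ v := csInf_le ⟨0, fun w hw => hw.1⟩ hv
  refine le_trans ?_ (mul_le_mul_of_nonneg_right hle (sq_nonneg _))
  rcases hm.1.eq_or_lt with h0 | h0
  · have h1 := hm.2 (star a * a)
    rw [← h0, zero_mul] at h1 ⊢
    have h2 : ‖φ (star a * a)‖ = 0 := by
      have := sq_nonneg ‖φ (star a * a)‖
      exact pow_eq_zero_iff (two_ne_zero) |>.1 (le_antisymm h1 this)
    exact (Complex.re_le_norm _).trans h2.le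
  · set w := variation φ with hwdef
    have happ : ∀ x, ((((w⁻¹ : ℝ) : ℂ) • φ) x) = ((w⁻¹ : ℝ) : ℂ) * φ x := fun x => rfl
    have hb : ∀ r : ℝ, r ∈ variationBounds (((w⁻¹ : ℝ) : ℂ) • φ) ↔ w * r ∈ variationBounds φ := by
      intro r
      have e1 : 0 ≤ r ↔ 0 ≤ w * r := (mul_nonneg_iff_of_pos_left h0).symm
      refine and_congr e1 (forall_congr' fun x => ?_)
      rw [happ, happ, Complex.re_ofReal_mul, norm_mul, Complex.norm_real, Real.norm_of_nonneg
        (inv_nonneg.2 h0.le), mul_pow]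
      have e2 : w⁻¹ ^ 2 * ‖φ x‖ ^ 2 = ‖φ x‖ ^ 2 / w ^ 2 := by field_simp
      have e3 : r * (w⁻¹ * (φ (star x * x)).re) = w * r * (φ (star x * x)).re / w ^ 2 := by
        field_simp
      rw [e2, e3, div_le_div_iff_of_pos_right (by positivity)]
    let ψ : State A := ⟨((w⁻¹ : ℝ) : ℂ) • φ, by
      refine ⟨fun x => ?_, fun b => ?_, ⟨1, (hb 1).2 (by rwa [mul_one])⟩, ?_⟩
      · rw [happ]
        exact mul_nonneg (by exact_mod_cast (inv_nonneg.2 h0.le)) (hp x)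
      · simp only [happ]
        exact continuous_const.mul (hw b)
      · refine le_antisymm (csInf_le ⟨0, fun r hr => hr.1⟩ ((hb 1).2 (by rwa [mul_one]))) ?_
        refine le_csInf ⟨1, (hb 1).2 (by rwa [mul_one])⟩ fun r hr => ?_
        have h3 : w ≤ w * r := csInf_le ⟨0, fun r hr => hr.1⟩ ((hb r).1 hr)
        exact le_of_mul_le_mul_left (by rwa [mul_one]) h0⟩
    have h4 := re_le_gn_sq ψ a
    have h5 : (ψ.1 (star a * a)).re = w⁻¹ * (φ (star a * a)).re := by
      show ((((w⁻¹ : ℝ) : ℂ) • φ) (star a * a)).re = _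
      rw [happ, Complex.re_ofReal_mul]
    rw [h5, inv_mul_le_iff₀ h0] at h4
    exact h4

theorem gn_mul_le (a b : A) : gnSeminorm (a * b) ≤ gnSeminorm a * gnSeminorm b := by
  refine gn_le (mul_nonneg (gn_nonneg a) (gn_nonneg b)) fun ψ => ?_
  have h1 := form_le_gn (conjFunctional_positive ψ.2.positive b)
    (conjFunctional_weaklyContinuous ψ.2.weaklyContinuous b)
    (conjFunctional_mem ψ.2.positive b) a
  have e : conjFunctional ψ.1 b (star a * a) = ψ.1 (star (a * b) * (a * b)) := by
    simp [conjFunctional, mul_assoc]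
  rw [e] at h1
  calc _ ≤ _ := h1
    _ ≤ gnSeminorm b ^ 2 * gnSeminorm a ^ 2 :=
      mul_le_mul_of_nonneg_right (re_le_gn_sq ψ b) (sq_nonneg _)
    _ = _ := by ring

theorem gn_sq_le (a : A) : gnSeminorm a ^ 2 ≤ gnSeminorm (star a * a) := by
  have h : gnSeminorm a ≤ √(gnSeminorm (star a * a)) := by
    refine gn_le (Real.sqrt_nonneg _) fun ψ => ?_
    rw [Real.sq_sqrt (gn_nonneg _)]
    refine le_trans ?_ (le_gn ψ (star a * a))
    refine Real.le_sqrt_of_sq_le ?_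
    have := ψ.mem_variationBounds.2 (star a * a)
    rw [one_mul] at this
    exact (pow_le_pow_left₀ (ψ.form_nonneg a) (Complex.re_le_norm _) 2).trans this
  have := pow_le_pow_left₀ (gn_nonneg a) h 2
  rwa [Real.sq_sqrt (gn_nonneg _)] at this

theorem gn_le_star (a : A) : gnSeminorm a ≤ gnSeminorm (star a) := by
  have h := (gn_sq_le a).trans (gn_mul_le (star a) a)
  rcases (gn_nonneg a).eq_or_lt with h0 | h0
  · rw [← h0]; exact gn_nonneg _
  · rw [sq] at h
    exact le_of_mul_le_mul_right h h0

theorem gn_star (a : A) : gnSeminorm (star a) = gnSeminorm a :=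
  le_antisymm (by simpa using gn_le_star (star a)) (gn_le_star a)

end Seminorm

section Construction

variable (A : Type u) [NonUnitalNormedRing A] [StarRing A] [NormedSpace ℂ A]

/-- The `*`-algebra `A`, regarded as a seminormed `*`-algebra under the Gelfand–Naimark
seminorm. -/
def GNAlgebra : Type u := A

instance : NonUnitalRing (GNAlgebra A) := inferInstanceAs (NonUnitalRing A)
instance : StarRing (GNAlgebra A) := inferInstanceAs (StarRing A)
instance : Module ℂ (GNAlgebra A) := inferInstanceAs (Module ℂ A)

variable [IsScalarTower ℂ A A] [SMulCommClass ℂ A A] [StarModule ℂ A]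

instance : IsScalarTower ℂ (GNAlgebra A) (GNAlgebra A) := inferInstanceAs (IsScalarTower ℂ A A)
instance : SMulCommClass ℂ (GNAlgebra A) (GNAlgebra A) := inferInstanceAs (SMulCommClass ℂ A A)
instance : StarModule ℂ (GNAlgebra A) := inferInstanceAs (StarModule ℂ A)

instance : NonUnitalSeminormedRing (GNAlgebra A) :=
  { (inferInstance : NonUnitalRing (GNAlgebra A)),
    AddGroupSeminorm.toSeminormedAddCommGroup (E := GNAlgebra A)
      { toFun := fun a => gnSeminorm (A := A) a
        map_zero' := gn_zero (A := A)
        add_le' := gn_add_le (A := A)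
        neg' := gn_neg (A := A) } with
    norm_mul_le := gn_mul_le (A := A) }

instance : NormedSpace ℂ (GNAlgebra A) where
  norm_smul_le c a := (gn_smul (A := A) c a).le

instance : NormedStarGroup (GNAlgebra A) where
  norm_star_le a := (gn_star (A := A) a).le

/-- The (Hausdorff) completion of `A` under the Gelfand–Naimark seminorm. -/
abbrev GNCompletion : Type u := UniformSpace.Completion (GNAlgebra A)

namespace GNCompletion

open UniformSpace UniformSpace.Completion

variable {A}

/-- The canonical map from `A` to `C*(A)`, as a function. -/
def ofAlg (a : GNAlgebra A) : GNCompletion A := (a : Completion (GNAlgebra A))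

theorem isDenseInducing_ofAlg : IsDenseInducing (ofAlg (A := A)) :=
  Completion.isDenseInducing_coe

theorem continuous_ofAlg : Continuous (ofAlg (A := A)) := isDenseInducing_ofAlg.continuous

theorem norm_ofAlg (a : GNAlgebra A) : ‖ofAlg a‖ = ‖a‖ := Completion.norm_coe a

theorem ofAlg_add (a b : GNAlgebra A) : ofAlg (a + b) = ofAlg a + ofAlg b := Completion.coe_add a b

theorem ofAlg_smul (c : ℂ) (a : GNAlgebra A) : ofAlg (c • a) = c • ofAlg a :=
  Completion.coe_smul c a

theorem ofAlg_zero : ofAlg (0 : GNAlgebra A) = 0 := Completion.coe_zero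

/-- Multiplication, extended by continuity. -/
instance : Mul (GNCompletion A) :=
  ⟨fun x y => (isDenseInducing_ofAlg.prodMap isDenseInducing_ofAlg).extend
    (fun p : GNAlgebra A × GNAlgebra A => ofAlg (p.1 * p.2)) (x, y)⟩

/-- The involution, extended by continuity. -/
instance : Star (GNCompletion A) :=
  ⟨Completion.map (star : GNAlgebra A → GNAlgebra A)⟩

theorem ofAlg_mul (a b : GNAlgebra A) : ofAlg (a * b) = ofAlg a * ofAlg b :=
  ((isDenseInducing_ofAlg.prodMap isDenseInducing_ofAlg).extend_eq
    (continuous_ofAlg.comp continuous_mul) (a, b)).symm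

theorem ofAlg_star (a : GNAlgebra A) : ofAlg (star a) = star (ofAlg a) :=
  (Completion.map_coe (starNormedAddGroupHom (E := GNAlgebra A)).uniformContinuous a).symm

instance : ContinuousMul (GNCompletion A) where
  continuous_mul := by
    let j : GNAlgebra A →+ GNCompletion A := ⟨⟨ofAlg, ofAlg_zero⟩, ofAlg_add⟩
    let m := (AddMonoidHom.mul : GNAlgebra A →+ GNAlgebra A →+ GNAlgebra A).compr₂ j
    have hm : Continuous fun p : GNAlgebra A × GNAlgebra A => m p.1 p.2 :=
      continuous_ofAlg.comp continuous_mul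
    have di : IsDenseInducing (j : GNAlgebra A → GNCompletion A) := isDenseInducing_ofAlg
    exact (di.extend_Z_bilin di hm :)

instance : ContinuousStar (GNCompletion A) where
  continuous_star := Completion.continuous_map

@[elab_as_elim]
theorem ind {p : GNCompletion A → Prop} (x : GNCompletion A) (hp : IsClosed {x | p x})
    (h : ∀ a, p (ofAlg a)) : p x := Completion.induction_on x hp h

@[elab_as_elim]
theorem ind₂ {p : GNCompletion A → GNCompletion A → Prop} (x y : GNCompletion A)
    (hp : IsClosed {q : GNCompletion A × GNCompletion A | p q.1 q.2})
    (h : ∀ a b, p (ofAlg a) (ofAlg b)) : p x y := Completion.induction_on₂ x y hp h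

@[elab_as_elim]
theorem ind₃ {p : GNCompletion A → GNCompletion A → GNCompletion A → Prop} (x y z : GNCompletion A)
    (hp : IsClosed {q : GNCompletion A × GNCompletion A × GNCompletion A | p q.1 q.2.1 q.2.2})
    (h : ∀ a b c, p (ofAlg a) (ofAlg b) (ofAlg c)) : p x y z := Completion.induction_on₃ x y z hp h

instance : NonUnitalNormedRing (GNCompletion A) :=
  { (inferInstance : NormedAddCommGroup (GNCompletion A)), (inferInstance : Mul (GNCompletion A)) with
    zero_mul x := ind x (isClosed_eq (by fun_prop) (by fun_prop)) fun a => by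
      rw [← ofAlg_zero, ← ofAlg_mul, zero_mul]
    mul_zero x := ind x (isClosed_eq (by fun_prop) (by fun_prop)) fun a => by
      rw [← ofAlg_zero, ← ofAlg_mul, mul_zero]
    mul_assoc x y z := ind₃ x y z (isClosed_eq (by fun_prop) (by fun_prop)) fun a b c => by
      simp only [← ofAlg_mul, mul_assoc]
    left_distrib x y z := ind₃ x y z (isClosed_eq (by fun_prop) (by fun_prop)) fun a b c => by
      simp only [← ofAlg_mul, ← ofAlg_add, mul_add]
    right_distrib x y z := ind₃ x y z (isClosed_eq (by fun_prop) (by fun_prop)) fun a b c => by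
      simp only [← ofAlg_mul, ← ofAlg_add, add_mul]
    norm_mul_le x y := ind₂ x y (isClosed_le (by fun_prop) (by fun_prop)) fun a b => by
      rw [← ofAlg_mul, norm_ofAlg, norm_ofAlg, norm_ofAlg]
      exact norm_mul_le a b }

instance : StarRing (GNCompletion A) where
  star_involutive x := ind x (isClosed_eq (by fun_prop) (by fun_prop)) fun a => by
    rw [← ofAlg_star, ← ofAlg_star, star_star]
  star_mul x y := ind₂ x y (isClosed_eq (by fun_prop) (by fun_prop)) fun a b => by
    simp only [← ofAlg_star, ← ofAlg_mul, star_mul]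
  star_add x y := ind₂ x y (isClosed_eq (by fun_prop) (by fun_prop)) fun a b => by
    simp only [← ofAlg_star, ← ofAlg_add, star_add]

instance : IsScalarTower ℂ (GNCompletion A) (GNCompletion A) where
  smul_assoc c x y := ind₂ x y
    (isClosed_eq ((continuous_fst.const_smul c).mul continuous_snd)
      ((continuous_fst.mul continuous_snd).const_smul c)) fun a b => by
      rw [smul_eq_mul, smul_eq_mul, ← ofAlg_smul, ← ofAlg_mul, ← ofAlg_mul, ← ofAlg_smul,
        smul_mul_assoc]

instance : SMulCommClass ℂ (GNCompletion A) (GNCompletion A) where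
  smul_comm c x y := ind₂ x y
    (isClosed_eq ((continuous_fst.mul continuous_snd).const_smul c)
      (continuous_fst.mul (continuous_snd.const_smul c))) fun a b => by
      rw [smul_eq_mul, smul_eq_mul, ← ofAlg_smul, ← ofAlg_mul, ← ofAlg_mul, ← ofAlg_smul,
        mul_smul_comm]

instance : StarModule ℂ (GNCompletion A) where
  star_smul c x := ind x
    (isClosed_eq (continuous_id.const_smul c).star (continuous_id.star.const_smul (star c)))
    fun a => by
      show star (c • ofAlg a) = star c • star (ofAlg a)
      rw [← ofAlg_smul, ← ofAlg_star, ← ofAlg_star, ← ofAlg_smul, star_smul]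

instance : CStarRing (GNCompletion A) where
  norm_mul_self_le x := ind x (isClosed_le (by fun_prop) (by fun_prop)) fun a => by
    rw [← ofAlg_star, ← ofAlg_mul, norm_ofAlg, norm_ofAlg, ← sq]
    exact gn_sq_le (A := A) a

instance : NonUnitalCStarAlgebra (GNCompletion A) where
  complete := CompleteSpace.complete
  norm_smul_le := norm_smul_le

end GNCompletion

/-- The enveloping C⋆-algebra `C*(A)`: the (Hausdorff) completion of `A` under the
Gelfand–Naimark seminorm, i.e. the completion of the quotient of `A` by the `*`-radical
`{a | ‖a‖ₒ = 0}` with the induced norm. -/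
def CStarEnv : Type u := GNCompletion A

instance : NonUnitalCStarAlgebra (CStarEnv A) :=
  inferInstanceAs (NonUnitalCStarAlgebra (GNCompletion A))

/-- The canonical `*`-algebra homomorphism `j : A → C*(A)`. -/
def toCStarEnv : A →⋆ₙₐ[ℂ] CStarEnv A where
  toFun a := GNCompletion.ofAlg (a : GNAlgebra A)
  map_smul' c a := GNCompletion.ofAlg_smul (A := A) c a
  map_zero' := GNCompletion.ofAlg_zero
  map_add' a b := GNCompletion.ofAlg_add (A := A) a b
  map_mul' a b := GNCompletion.ofAlg_mul (A := A) a b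
  map_star' a := GNCompletion.ofAlg_star (A := A) a

theorem norm_toCStarEnv (a : A) : ‖toCStarEnv A a‖ = gnSeminorm a :=
  GNCompletion.norm_ofAlg (A := A) a

theorem denseRange_toCStarEnv : DenseRange (toCStarEnv A) :=
  GNCompletion.isDenseInducing_ofAlg.dense

end Construction

section StateSpaces

variable {A : Type u} [NonUnitalNormedRing A] [StarRing A] [NormedSpace ℂ A]
  [IsScalarTower ℂ A A] [SMulCommClass ℂ A A] [StarModule ℂ A]

/-- The element of the dual of the real normed space `A_sa` given by a quasi-state. (Quasi-states
are Hermitian, so they are real on `A_sa`, and they are determined by their values there.) -/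
def QuasiState.toWeakDual (φ : QuasiState A) : WeakDual ℝ (selfAdjoint A) :=
  StrongDual.toWeakDual
    { toFun := fun h => (φ.1 (h : A)).re
      map_add' := fun h k => by simp
      map_smul' := fun c h => by
        have : φ.1 (c • (h : A)) = (c : ℂ) * φ.1 (h : A) := by
          rw [← Complex.coe_smul, map_smul, smul_eq_mul]
        simp [this]
      cont := by
        refine Complex.continuous_re.comp ?_
        have hv := mem_variationBounds φ.2.positive φ.2.finiteVariation
        refine AddMonoidHomClass.continuous_of_bound
          ((φ.1 : A →+ ℂ).comp (selfAdjoint A).subtype) (variation φ.1) fun h => ?_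
        exact norm_le_of_isSelfAdjoint φ.2.positive φ.2.weaklyContinuous hv h h.2 }

/-- The weak* topology on `QS(A)`. -/
instance : TopologicalSpace (QuasiState A) :=
  TopologicalSpace.induced QuasiState.toWeakDual inferInstance

variable (A) in
/-- `S(A)` as a subset of `QS(A)`. -/
def stateSet : Set (QuasiState A) := {φ | IsState φ.1}

end StateSpaces

end

end EnvCStar

/-! By construction `‖j(a)‖ = ‖a‖ₒ` and `j(A)` is dense in `C*(A)`, so an object on `A` extends to
`C*(A)` once it is bounded by `‖·‖ₒ`; uniqueness comes from automatic continuity over a C⋆-algebra.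

Boundedness comes from `form_le_gn`, i.e. `φ(a⋆a) ≤ v ‖a‖ₒ²`. With finite variation it gives `|φ(a)|
≤ v ‖a‖ₒ`. Applied to the vector functionals `⟪x, π(·)x⟫` of a σ-contractive representation, it
gives `‖π(a)‖ ≤ ‖a‖ₒ`.

Conversely, pullbacks have the required properties because `‖h‖ₒ ≤ |h|` for self-adjoint `h`, which
yields weak continuity, and because `‖a‖ₒ ≤ r_σ(a)` (`gn_le_rSigma`), which comes from the equality
of norm and spectral radius for self-adjoint elements of a C⋆-algebra.

Variation is preserved since its defining inequality passes from `j(A)` to the closure. On a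
C⋆-algebra it is the limit of `φ(e⋆e)` along an approximate unit, hence additive; this makes the
states convex, first on `C*(A)` and then on `A`. The bijection of quasi-states is a homeomorphism
because quasi-states are contractive on self-adjoint elements and `j(A_sa)` is dense in the
self-adjoint part of `C*(A)`. -/

namespace EnvCStar

open Filter Topology

/-! ### Powers and the functions `r_λ`, `r_σ`. -/

section Powers

variable {A : Type u} [NonUnitalNormedRing A]

theorem rLambda_le_norm (a : A) : rLambda a ≤ ‖a‖ := by
  have h : BddBelow (Set.range fun n : ℕ => ‖(fun x : A => a * x)^[n] a‖ ^ ((1 : ℝ) / (n + 1))) :=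
    ⟨0, by rintro _ ⟨n, rfl⟩; positivity⟩
  exact (ciInf_le h 0).trans_eq (by simp)

theorem rSigma_le_norm_of_isSelfAdjoint [StarRing A] {h : A} (hh : IsSelfAdjoint h) :
    rSigma h ≤ ‖h‖ := by
  refine Real.sqrt_le_iff.2 ⟨norm_nonneg h, (rLambda_le_norm _).trans ?_⟩
  rw [hh.star_eq, sq]
  exact norm_mul_le h h

/-- Commutation is carried along in the induction because a product of two self-adjoint elements is
self-adjoint exactly when they commute. -/
theorem isSelfAdjoint_iterate_mul [StarRing A] {h : A} (hh : IsSelfAdjoint h) (n : ℕ) :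
    IsSelfAdjoint ((fun x : A => h * x)^[n] h) ∧ Commute h ((fun x : A => h * x)^[n] h) := by
  induction n with
  | zero => exact ⟨hh, Commute.refl h⟩
  | succ n ih =>
    rw [Function.iterate_succ_apply']
    exact ⟨(hh.commute_iff ih.1).1 ih.2, (Commute.refl h).mul_right ih.2⟩

end Powers

/-! ### Convex combinations and quasi-states on a general `*`-algebra. -/

section General

variable {A : Type u} [NonUnitalNormedRing A] [StarRing A] [NormedSpace ℂ A]

theorem IsPositive.re_nonneg {φ : A →ₗ[ℂ] ℂ} (hp : IsPositive φ) (a : A) :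
    0 ≤ (φ (star a * a)).re :=
  (Complex.le_def.1 (hp a)).1

theorem bddBelow_variationBounds (φ : A →ₗ[ℂ] ℂ) : BddBelow (variationBounds φ) :=
  ⟨0, fun _ h => h.1⟩

theorem variation_le {φ : A →ₗ[ℂ] ℂ} {v : ℝ} (hv : v ∈ variationBounds φ) : variation φ ≤ v :=
  csInf_le (bddBelow_variationBounds φ) hv

theorem IsPositive.convexComb {φ₁ φ₂ : A →ₗ[ℂ] ℂ} (h₁ : IsPositive φ₁) (h₂ : IsPositive φ₂)
    {s t : ℝ} (hs : 0 ≤ s) (ht : 0 ≤ t) : IsPositive (s • φ₁ + t • φ₂) := fun a => by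
  have e : (s • φ₁ + t • φ₂) (star a * a) =
      (s : ℂ) * φ₁ (star a * a) + (t : ℂ) * φ₂ (star a * a) := by simp
  rw [e]
  exact add_nonneg (mul_nonneg (by exact_mod_cast hs) (h₁ a))
    (mul_nonneg (by exact_mod_cast ht) (h₂ a))

theorem WeaklyContinuousOnSA.convexComb {φ₁ φ₂ : A →ₗ[ℂ] ℂ} (h₁ : WeaklyContinuousOnSA φ₁)
    (h₂ : WeaklyContinuousOnSA φ₂) (s t : ℝ) : WeaklyContinuousOnSA (s • φ₁ + t • φ₂) :=
  fun b => ((h₁ b).const_smul s).add ((h₂ b).const_smul t)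

/-- This rests on convexity of the square. It settles convexity of the quasi-states, but bounds the
variation only from above, which is not enough for states. -/
theorem one_mem_variationBounds_convexComb {φ₁ φ₂ : A →ₗ[ℂ] ℂ} (h₁ : 1 ∈ variationBounds φ₁)
    (h₂ : 1 ∈ variationBounds φ₂) {s t : ℝ} (hs : 0 ≤ s) (ht : 0 ≤ t) (hst : s + t = 1) :
    1 ∈ variationBounds (s • φ₁ + t • φ₂) := by
  refine ⟨zero_le_one, fun a => ?_⟩
  have e : ((s • φ₁ + t • φ₂) (star a * a)).re =
      s * (φ₁ (star a * a)).re + t * (φ₂ (star a * a)).re := by simp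
  have h : ‖(s • φ₁ + t • φ₂) a‖ ≤ s * ‖φ₁ a‖ + t * ‖φ₂ a‖ := by
    refine (norm_add_le _ _).trans_eq ?_
    simp [abs_of_nonneg hs, abs_of_nonneg ht]
  have h3 := h₁.2 a
  have h4 := h₂.2 a
  rw [one_mul] at h3 h4 ⊢
  rw [e]
  calc ‖(s • φ₁ + t • φ₂) a‖ ^ 2 ≤ (s * ‖φ₁ a‖ + t * ‖φ₂ a‖) ^ 2 :=
        pow_le_pow_left₀ (norm_nonneg _) h 2
    _ ≤ s * ‖φ₁ a‖ ^ 2 + t * ‖φ₂ a‖ ^ 2 := by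
        obtain rfl : t = 1 - s := by linarith
        -- The difference of the two sides is exactly `s t (‖φ₁ a‖ - ‖φ₂ a‖)²`.
        nlinarith [mul_nonneg (mul_nonneg hs ht) (sq_nonneg (‖φ₁ a‖ - ‖φ₂ a‖))]
    _ ≤ _ := add_le_add (mul_le_mul_of_nonneg_left h3 hs) (mul_le_mul_of_nonneg_left h4 ht)

theorem IsQuasiState.one_mem {φ : A →ₗ[ℂ] ℂ} (h : IsQuasiState φ) : 1 ∈ variationBounds φ := by
  have hm := mem_variationBounds h.positive h.finiteVariation
  refine ⟨zero_le_one, fun a => (hm.2 a).trans ?_⟩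
  exact mul_le_mul_of_nonneg_right h.variation_le_one (h.positive.re_nonneg a)

theorem IsQuasiState.isState {φ : A →ₗ[ℂ] ℂ} (h : IsQuasiState φ) (hv : variation φ = 1) :
    IsState φ :=
  ⟨h.positive, h.weaklyContinuous, h.finiteVariation, hv⟩

variable (A) in
theorem convex_isQuasiState : Convex ℝ {φ : A →ₗ[ℂ] ℂ | IsQuasiState φ} := by
  intro φ₁ h₁ φ₂ h₂ s t hs ht hst
  have hm := one_mem_variationBounds_convexComb (IsQuasiState.one_mem h₁)
    (IsQuasiState.one_mem h₂) hs ht hst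
  exact ⟨h₁.positive.convexComb h₂.positive hs ht,
    h₁.weaklyContinuous.convexComb h₂.weaklyContinuous s t, ⟨1, hm⟩, variation_le hm⟩

end General

/-! ### Positive functionals and self-adjoint elements in C⋆-algebras. -/

section CStar

variable {B : Type u} [NonUnitalCStarAlgebra B]

/-- The positive elements of the spectral order are those of the form `y⋆y`, so `φ` is monotone, and
positive maps between C⋆-algebras are automatically continuous. -/
theorem IsPositive.continuous {φ : B →ₗ[ℂ] ℂ} (hp : IsPositive φ) : Continuous φ := by
  let _ := CStarAlgebra.spectralOrder B
  have := CStarAlgebra.spectralOrderedRing B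
  let f : B →ₚ[ℂ] ℂ := PositiveLinearMap.mk₀ φ fun x hx => by
    obtain ⟨y, rfl⟩ := (CStarAlgebra.nonneg_iff_eq_star_mul_self).1 hx
    exact hp y
  exact map_continuous f

/-- Positive functionals on a C⋆-algebra have finite variation, bounded by their norm. -/
theorem IsPositive.hasFiniteVariation {φ : B →ₗ[ℂ] ℂ} (hp : IsPositive φ) :
    HasFiniteVariation φ := by
  let _ := CStarAlgebra.spectralOrder B
  have := CStarAlgebra.spectralOrderedRing B
  have hl := CStarAlgebra.increasingApproximateUnit B
  let F : B →L[ℂ] ℂ := ⟨φ, hp.continuous⟩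
  refine ⟨‖F‖, norm_nonneg F, fun a => ?_⟩
  -- An approximate unit replaces the missing unit: Cauchy–Schwarz bounds `|φ(ea)|²` by `φ(ee)
  -- φ(a⋆a)`, and `ea → a`.
  have h1 : Tendsto (fun e => ‖φ (e * a)‖ ^ 2) (CStarAlgebra.approximateUnit B)
      (𝓝 (‖φ a‖ ^ 2)) :=
    ((hp.continuous.tendsto a).comp (hl.tendsto_mul_right a)).norm.pow 2
  refine le_of_tendsto h1 ?_
  filter_upwards [hl.eventually_star_eq, hl.eventually_norm] with e he hn
  have h2 := form_cauchySchwarz hp e a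
  rw [he] at h2
  refine h2.trans (mul_le_mul_of_nonneg_right ?_ (hp.re_nonneg a))
  calc (φ (e * e)).re ≤ ‖F (e * e)‖ := Complex.re_le_norm _
    _ ≤ ‖F‖ * ‖e * e‖ := F.le_opNorm _
    _ ≤ ‖F‖ * 1 := mul_le_mul_of_nonneg_left
        ((norm_mul_le e e).trans (mul_le_one₀ hn (norm_nonneg _) hn)) (norm_nonneg _)
    _ = ‖F‖ := mul_one _

theorem IsPositive.weaklyContinuous {φ : B →ₗ[ℂ] ℂ} (hp : IsPositive φ) :
    WeaklyContinuousOnSA φ := fun b => by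
  have := hp.continuous
  fun_prop

/-- The variation is the limit along an approximate unit `(e)` of `φ (e⋆ e)`. -/
theorem IsPositive.tendsto_variation {φ : B →ₗ[ℂ] ℂ} (hp : IsPositive φ) {l : Filter B}
    (hl : l.IsApproximateUnit) (hs : ∀ᶠ e in l, star e = e) (hn : ∀ᶠ e in l, ‖e‖ ≤ 1) :
    Tendsto (fun e => (φ (star e * e)).re) l (𝓝 (variation φ)) := by
  have hm := mem_variationBounds hp hp.hasFiniteVariation
  refine tendsto_order.2 ⟨fun c hc => ?_, fun c hc => ?_⟩
  · by_contra hcon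
    -- If `φ(e⋆e) ≤ c` holds merely frequently, Cauchy–Schwarz in the limit already makes `c` a
    -- variation bound, contradicting `c < variation φ`.
    have hf : ∃ᶠ e in l, (φ (star e * e)).re ≤ c := by
      simpa [Filter.not_eventually] using hcon
    obtain ⟨e, he⟩ := hf.exists
    refine hc.not_ge (variation_le ⟨(hp.re_nonneg e).trans he, fun a => ?_⟩)
    have h1 : Tendsto (fun e => ‖φ (e * a)‖ ^ 2) l (𝓝 (‖φ a‖ ^ 2)) :=
      ((hp.continuous.tendsto a).comp (hl.tendsto_mul_right a)).norm.pow 2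
    refine le_of_tendsto_of_frequently h1 ((hf.and_eventually hs).mono fun e he => ?_)
    have h2 := (form_cauchySchwarz hp e a).trans
      (mul_le_mul_of_nonneg_right he.1 (hp.re_nonneg a))
    rwa [he.2] at h2
  · filter_upwards [hn] with e he
    refine lt_of_le_of_lt ?_ hc
    have h := norm_le_of_isSelfAdjoint hp hp.weaklyContinuous hm _ (IsSelfAdjoint.star_mul_self e)
    refine ((Complex.re_le_norm _).trans h).trans ?_
    rw [CStarRing.norm_star_mul_self]
    exact mul_le_of_le_one_right hm.1 (mul_le_one₀ he (norm_nonneg _) he)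

/-- One approximate unit serves all positive functionals, and the variation is a limit along it of
expressions linear in the functional. -/
theorem variation_convexComb {φ₁ φ₂ : B →ₗ[ℂ] ℂ} (h₁ : IsPositive φ₁) (h₂ : IsPositive φ₂)
    {s t : ℝ} (hs : 0 ≤ s) (ht : 0 ≤ t) :
    variation (s • φ₁ + t • φ₂) = s * variation φ₁ + t * variation φ₂ := by
  let _ := CStarAlgebra.spectralOrder B
  have := CStarAlgebra.spectralOrderedRing B
  have hl := CStarAlgebra.increasingApproximateUnit B
  have key : ∀ {φ : B →ₗ[ℂ] ℂ}, IsPositive φ → _ := fun {φ} hp =>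
    hp.tendsto_variation hl.toIsApproximateUnit hl.eventually_star_eq hl.eventually_norm
  refine tendsto_nhds_unique (key (h₁.convexComb h₂ hs ht))
    ((((key h₁).const_mul s).add ((key h₂).const_mul t)).congr fun e => ?_)
  simp

theorem isState_convexComb {φ₁ φ₂ : B →ₗ[ℂ] ℂ} (h₁ : IsState φ₁) (h₂ : IsState φ₂)
    {s t : ℝ} (hs : 0 ≤ s) (ht : 0 ≤ t) (hst : s + t = 1) : IsState (s • φ₁ + t • φ₂) := by
  have hp := h₁.positive.convexComb h₂.positive hs ht
  refine ⟨hp, hp.weaklyContinuous, hp.hasFiniteVariation, ?_⟩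
  rw [variation_convexComb h₁.positive h₂.positive hs ht, h₁.variation_eq_one,
    h₂.variation_eq_one, mul_one, mul_one, hst]

/-- The spectral radius formula for self-adjoint elements, with the powers of `x` written as in
`rLambda`. -/
theorem norm_le_iterate_of_isSelfAdjoint {x : B} (hx : IsSelfAdjoint x) (n : ℕ) :
    ‖x‖ ≤ ‖(fun y : B => x * y)^[n] x‖ ^ ((1 : ℝ) / (n + 1)) := by
  -- Spectra are taken in the unitization, into which `B` embeds isometrically.
  let y : Unitization ℂ B := x
  have hy : IsSelfAdjoint y := hx.inr ℂ
  have hpow : ∀ n : ℕ, (((fun y : B => x * y)^[n] x : B) : Unitization ℂ B) = y ^ (n + 1) := by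
    intro n
    induction n with
    | zero => simp [y]
    | succ n ih => rw [Function.iterate_succ_apply', Unitization.inr_mul, ih, pow_succ' y (n + 1)]
  have h := spectrum.spectralRadius_le_pow_nnnorm_pow_one_div ℂ y n
  rw [hy.spectralRadius_eq_nnnorm, nnnorm_one, ENNReal.coe_one, ENNReal.one_rpow, mul_one,
    ← ENNReal.coe_rpow_of_nonneg _ (by positivity), ENNReal.coe_le_coe, ← hpow] at h
  have h' := NNReal.coe_le_coe.2 h
  simpa [y, Unitization.norm_inr] using h'

end CStar

/-! ### Estimates for the canonical map `j`. -/

section Envelope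

variable {A : Type u} [NonUnitalNormedRing A] [StarRing A] [NormedSpace ℂ A]
  [IsScalarTower ℂ A A] [SMulCommClass ℂ A A] [StarModule ℂ A]

/-- This makes `j` contractive on `A_sa`. The argument needs `h⋆ = h`, as the involution is not
assumed continuous. -/
theorem gn_le_norm_of_isSelfAdjoint {h : A} (hh : IsSelfAdjoint h) : gnSeminorm h ≤ ‖h‖ :=
  gn_le (norm_nonneg h) fun ψ => by
    rw [hh.star_eq]
    have := form_le_of_isSelfAdjoint ψ.2.positive ψ.2.weaklyContinuous ψ.mem_variationBounds h hh
    rwa [one_mul, ← sq] at this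

/-- The restriction of `j` to `A_sa`, as a map into the self-adjoint part of `C*(A)`. -/
noncomputable def toCStarEnvSA (h : selfAdjoint A) : selfAdjoint (CStarEnv A) :=
  ⟨toCStarEnv A h, (h.2 : IsSelfAdjoint (h : A)).map (toCStarEnv A)⟩

theorem continuous_toCStarEnv_selfAdjoint :
    Continuous fun h : selfAdjoint A => toCStarEnv A (h : A) :=
  AddMonoidHomClass.continuous_of_bound
    (((toCStarEnv A : A →ₗ[ℂ] CStarEnv A) : A →+ CStarEnv A).comp (selfAdjoint A).subtype) 1
    fun h => by
      rw [one_mul]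
      exact (norm_toCStarEnv A (h : A)).trans_le (gn_le_norm_of_isSelfAdjoint h.2)

/-- Taking real parts is contractive and fixes `k`, so if `j(a)` is within `ε` of `k`, so is `j((a +
a⋆)/2)`. -/
theorem denseRange_toCStarEnvSA : DenseRange (toCStarEnvSA (A := A)) := by
  intro k
  have hk : star (k : CStarEnv A) = k := k.2
  refine Metric.mem_closure_range_iff.2 fun ε hε => ?_
  obtain ⟨a, ha⟩ := Metric.mem_closure_range_iff.1 (denseRange_toCStarEnv A (k : CStarEnv A)) ε hε
  have hsa : IsSelfAdjoint ((2⁻¹ : ℂ) • (a + star a)) := by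
    rw [IsSelfAdjoint, star_smul, star_add, star_star, add_comm]
    simp
  refine ⟨⟨_, hsa⟩, ?_⟩
  change dist (k : CStarEnv A) (toCStarEnv A ((2⁻¹ : ℂ) • (a + star a))) < ε
  rw [dist_eq_norm] at ha ⊢
  have e : (k : CStarEnv A) - toCStarEnv A ((2⁻¹ : ℂ) • (a + star a)) =
      (2⁻¹ : ℂ) • ((k - toCStarEnv A a) + star (k - toCStarEnv A a)) := by
    rw [map_smul, map_add, map_star, star_sub, hk]
    module
  rw [e, norm_smul]
  have h2 := norm_add_le ((k : CStarEnv A) - toCStarEnv A a) (star (k - toCStarEnv A a))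
  rw [norm_star] at h2
  rw [norm_inv, Complex.norm_ofNat]
  linarith

theorem toCStarEnv_iterate (a : A) (n : ℕ) :
    toCStarEnv A ((fun x : A => a * x)^[n] a) =
      (fun y : CStarEnv A => toCStarEnv A a * y)^[n] (toCStarEnv A a) := by
  induction n with
  | zero => rfl
  | succ n ih => rw [Function.iterate_succ_apply', Function.iterate_succ_apply', map_mul, ih]

/-- In `C*(A)` one has `‖j(h)‖ ≤ ‖j(h)^n‖^(1/n)`, and `‖j(h^n)‖ ≤ |h^n|` because `h^n` is again
self-adjoint. -/
theorem gn_le_rLambda {h : A} (hh : IsSelfAdjoint h) : gnSeminorm h ≤ rLambda h := by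
  refine le_ciInf fun n => ?_
  have h1 := norm_le_iterate_of_isSelfAdjoint (hh.map (toCStarEnv A)) n
  rw [← toCStarEnv_iterate, norm_toCStarEnv, norm_toCStarEnv] at h1
  exact h1.trans (Real.rpow_le_rpow (gn_nonneg _)
    (gn_le_norm_of_isSelfAdjoint (isSelfAdjoint_iterate_mul hh n).1) (by positivity))

theorem gn_le_rSigma (a : A) : gnSeminorm a ≤ rSigma a :=
  Real.le_sqrt_of_sq_le ((gn_sq_le a).trans (gn_le_rLambda (IsSelfAdjoint.star_mul_self a)))

/-! ### Restriction and extension of positive functionals. -/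

section PullBack

variable {φ₀ : CStarEnv A →ₗ[ℂ] ℂ}

theorem pullback_isPositive (hp : IsPositive φ₀) :
    IsPositive (φ₀ ∘ₗ (toCStarEnv A : A →ₗ[ℂ] CStarEnv A)) := fun a => by
  have := hp (toCStarEnv A a)
  rwa [← map_star, ← map_mul] at this

/-- Both sides of the variation inequality are continuous on `C*(A)`, so it need only be tested on
the dense image of `j`. -/
theorem pullback_variationBounds (hp : IsPositive φ₀) :
    variationBounds (φ₀ ∘ₗ (toCStarEnv A : A →ₗ[ℂ] CStarEnv A)) = variationBounds φ₀ := by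
  have hc := hp.continuous
  ext v
  refine and_congr_right fun _ => ⟨fun h x => ?_, fun h a => ?_⟩
  · refine (denseRange_toCStarEnv A).induction_on (p := fun x =>
      ‖φ₀ x‖ ^ 2 ≤ v * (φ₀ (star x * x)).re) x (isClosed_le (by fun_prop) (by fun_prop)) fun a => ?_
    have := h a
    rw [← map_star, ← map_mul]
    exact this
  · have := h (toCStarEnv A a)
    rw [← map_star, ← map_mul] at this
    exact this

theorem pullback_variation (hp : IsPositive φ₀) :
    variation (φ₀ ∘ₗ (toCStarEnv A : A →ₗ[ℂ] CStarEnv A)) = variation φ₀ :=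
  congrArg sInf (pullback_variationBounds hp)

theorem pullback_hasFiniteVariation (hp : IsPositive φ₀) :
    HasFiniteVariation (φ₀ ∘ₗ (toCStarEnv A : A →ₗ[ℂ] CStarEnv A)) := by
  rw [HasFiniteVariation, pullback_variationBounds hp]
  exact hp.hasFiniteVariation

theorem pullback_weaklyContinuous (hp : IsPositive φ₀) :
    WeaklyContinuousOnSA (φ₀ ∘ₗ (toCStarEnv A : A →ₗ[ℂ] CStarEnv A)) := fun b => by
  have hc := hp.continuous
  have hj := continuous_toCStarEnv_selfAdjoint (A := A)
  have e : (fun h : selfAdjoint A =>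
      (φ₀ ∘ₗ (toCStarEnv A : A →ₗ[ℂ] CStarEnv A)) (star b * (h : A) * b)) =
      fun h : selfAdjoint A =>
        φ₀ (toCStarEnv A (star b) * toCStarEnv A (h : A) * toCStarEnv A b) := by
    ext h
    rw [← map_mul, ← map_mul]
    rfl
  rw [e]
  fun_prop

theorem pullback_injOn : Set.InjOn
    (fun φ₀ : CStarEnv A →ₗ[ℂ] ℂ => φ₀ ∘ₗ (toCStarEnv A : A →ₗ[ℂ] CStarEnv A))
    {φ₀ | IsPositive φ₀} := fun _ h₁ _ h₂ h =>
  DFunLike.coe_injective ((denseRange_toCStarEnv A).equalizer (IsPositive.continuous h₁)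
    (IsPositive.continuous h₂) (funext fun a => LinearMap.congr_fun h a))

/-- Finite variation and `form_le_gn` combine to `|φ(a)| ≤ v(φ) ‖j(a)‖`, so `φ` extends by
continuity; positivity is a closed condition. -/
theorem exists_isPositive_comp_eq {φ : A →ₗ[ℂ] ℂ} (hp : IsPositive φ)
    (hf : HasFiniteVariation φ) (hw : WeaklyContinuousOnSA φ) :
    ∃ φ₀ : CStarEnv A →ₗ[ℂ] ℂ, IsPositive φ₀ ∧
      φ₀ ∘ₗ (toCStarEnv A : A →ₗ[ℂ] CStarEnv A) = φ := by
  have hm := mem_variationBounds hp hf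
  have hbound : ∀ a, ‖φ a‖ ≤ variation φ * ‖(toCStarEnv A : A →ₗ[ℂ] CStarEnv A) a‖ := fun a => by
    have e : ‖(toCStarEnv A : A →ₗ[ℂ] CStarEnv A) a‖ = gnSeminorm a := norm_toCStarEnv A a
    rw [e]
    refine le_of_sq_le_sq ?_ (mul_nonneg hm.1 (gn_nonneg a))
    calc _ ≤ _ := hm.2 a
      _ ≤ variation φ * (variation φ * gnSeminorm a ^ 2) :=
        mul_le_mul_of_nonneg_left (form_le_gn hp hw hm a) hm.1
      _ = _ := by ring
  let F := φ.extendOfNorm (toCStarEnv A : A →ₗ[ℂ] CStarEnv A)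
  have hF : ∀ a, F (toCStarEnv A a) = φ a :=
    LinearMap.extendOfNorm_eq (denseRange_toCStarEnv A) ⟨_, hbound⟩
  refine ⟨F, fun x => ?_, LinearMap.ext hF⟩
  refine (denseRange_toCStarEnv A).induction_on (p := fun x => 0 ≤ F (star x * x)) x
    (isClosed_le (by fun_prop) (by fun_prop)) fun a => ?_
  rw [← map_star, ← map_mul, hF]
  exact hp a

end PullBack

variable (A) in
theorem bijOn_positive : Set.BijOn
    (fun φ₀ : CStarEnv A →ₗ[ℂ] ℂ => φ₀ ∘ₗ (toCStarEnv A : A →ₗ[ℂ] CStarEnv A))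
    {φ₀ | IsPositive φ₀}
    {φ : A →ₗ[ℂ] ℂ | IsPositive φ ∧ HasFiniteVariation φ ∧ WeaklyContinuousOnSA φ} :=
  ⟨fun _ hp => ⟨pullback_isPositive hp, pullback_hasFiniteVariation hp,
      pullback_weaklyContinuous hp⟩, pullback_injOn,
    fun _ h => exists_isPositive_comp_eq h.1 h.2.1 h.2.2⟩

variable (A) in
-- States of `A` are lifted to `C*(A)` with the same variation, where variation is additive.
theorem convex_isState : Convex ℝ {φ : A →ₗ[ℂ] ℂ | IsState φ} := by
  intro φ₁ h₁ φ₂ h₂ s t hs ht hst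
  obtain ⟨χ₁, p₁, rfl⟩ := exists_isPositive_comp_eq h₁.positive h₁.finiteVariation
    h₁.weaklyContinuous
  obtain ⟨χ₂, p₂, rfl⟩ := exists_isPositive_comp_eq h₂.positive h₂.finiteVariation
    h₂.weaklyContinuous
  have v₁ := (pullback_variation p₁).symm.trans h₁.variation_eq_one
  have v₂ := (pullback_variation p₂).symm.trans h₂.variation_eq_one
  have hp := p₁.convexComb p₂ hs ht
  refine (⟨pullback_isPositive hp, pullback_weaklyContinuous hp, pullback_hasFiniteVariation hp,
    ?_⟩ : IsState ((s • χ₁ + t • χ₂) ∘ₗ (toCStarEnv A : A →ₗ[ℂ] CStarEnv A)))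
  rw [pullback_variation hp, variation_convexComb p₁ p₂ hs ht, v₁, v₂, mul_one, mul_one, hst]

end Envelope

/-! ### Representations and their vector functionals. -/

section Representations

variable {A : Type u} [NonUnitalNormedRing A] [StarRing A] [NormedSpace ℂ A]
  {H : Type v} [NormedAddCommGroup H] [InnerProductSpace ℂ H]

theorem StarRep.ext_toFun {π ρ : StarRep A H} (h : ∀ a, π.toFun a = ρ.toFun a) : π = ρ := by
  obtain ⟨f, _⟩ := π
  obtain ⟨g, _⟩ := ρ
  obtain rfl : f = g := DFunLike.ext f g h
  rfl

theorem StarRep.norm_apply_sq (π : StarRep A H) (a : A) (x : H) :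
    ((‖π.toFun a x‖ ^ 2 : ℝ) : ℂ) = inner ℂ x (π.toFun (star a * a) x) := by
  have h : π.toFun (star a * a) = π.toFun (star a) * π.toFun a := π.map_mul' _ _
  rw [h, Module.End.mul_apply, ← π.inner_left, inner_self_eq_norm_sq_to_K]
  norm_cast

/-- The functional `a ↦ ⟪x, π a x⟫`. -/
noncomputable def StarRep.vectorFunctional (π : StarRep A H) (x : H) : A →ₗ[ℂ] ℂ where
  toFun a := inner ℂ x (π.toFun a x)
  map_add' a b := by
    have h : π.toFun (a + b) = π.toFun a + π.toFun b := π.map_add' a b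
    rw [h, LinearMap.add_apply, inner_add_right]
  map_smul' c a := by
    have h : π.toFun (c • a) = c • π.toFun a := π.map_smul' c a
    rw [h, LinearMap.smul_apply, inner_smul_right]
    rfl

theorem StarRep.vectorFunctional_star_mul_self (π : StarRep A H) (x : H) (a : A) :
    π.vectorFunctional x (star a * a) = ((‖π.toFun a x‖ ^ 2 : ℝ) : ℂ) :=
  (π.norm_apply_sq a x).symm

theorem StarRep.isPositive_vectorFunctional (π : StarRep A H) (x : H) :
    IsPositive (π.vectorFunctional x) := fun a => by
  rw [π.vectorFunctional_star_mul_self]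
  exact Complex.zero_le_real.2 (sq_nonneg _)

theorem StarRep.norm_sq_mem_variationBounds (π : StarRep A H) (x : H) :
    ‖x‖ ^ 2 ∈ variationBounds (π.vectorFunctional x) := by
  refine ⟨sq_nonneg _, fun a => ?_⟩
  rw [π.vectorFunctional_star_mul_self, Complex.ofReal_re, ← mul_pow]
  exact pow_le_pow_left₀ (norm_nonneg _) (norm_inner_le_norm _ _) 2

variable [CompleteSpace H]

/-- For self-adjoint `h`, σ-contractivity gives `‖π(h)‖ ≤ r_σ(h) ≤ |h|`, and `⟪x, π(b⋆hb)x⟫ =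
⟪π(b)x, π(h)π(b)x⟫`. -/
theorem StarRep.weaklyContinuousOnSA_vectorFunctional {π : StarRep A H}
    (hπ : IsSigmaContractive π.op) (x : H) : WeaklyContinuousOnSA (π.vectorFunctional x) := by
  have hc : Continuous fun h : selfAdjoint A => π.op (h : A) :=
    AddMonoidHomClass.continuous_of_bound ((π.op : A →+ (H →L[ℂ] H)).comp
      (selfAdjoint A).subtype) 1 fun h => by
        rw [one_mul]
        exact (hπ h).trans (rSigma_le_norm_of_isSelfAdjoint h.2)
  intro b
  have e : (fun h : selfAdjoint A => π.vectorFunctional x (star b * (h : A) * b)) =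
      fun h : selfAdjoint A => inner ℂ (π.toFun b x) (π.op (h : A) (π.toFun b x)) := by
    ext h
    have h1 : π.toFun (star b * (h : A) * b) = π.toFun (star b) * π.toFun (h : A) * π.toFun b :=
      (π.map_mul' _ _).trans (congrArg (· * π.toFun b) (π.map_mul' _ _))
    change inner ℂ x (π.toFun (star b * (h : A) * b) x) =
      inner ℂ (π.toFun b x) (π.toFun (h : A) (π.toFun b x))
    rw [h1, π.inner_left]
    rfl
  rw [e]
  fun_prop

/-- A representation in a Hilbert space as a `*`-homomorphism into the bounded operators. -/
noncomputable def StarRep.starHom (π : StarRep A H) : A →⋆ₙₐ[ℂ] (H →L[ℂ] H) where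
  toFun := π.op
  map_smul' c a := map_smul π.op c a
  map_zero' := map_zero π.op
  map_add' a b := map_add π.op a b
  map_mul' a b := by
    ext x
    exact congrArg (fun T : Module.End ℂ H => T x) (π.map_mul' a b)
  map_star' a := by
    rw [ContinuousLinearMap.star_eq_adjoint]
    refine (ContinuousLinearMap.eq_adjoint_iff _ _).2 fun x y => ?_
    have h := π.inner_left (star a) x y
    rw [star_star] at h
    exact h

theorem StarRep.norm_op_le {B : Type*} [NonUnitalCStarAlgebra B] (π : StarRep B H) (b : B) :
    ‖π.op b‖ ≤ ‖b‖ :=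
  NonUnitalStarAlgHom.norm_apply_le π.starHom b

theorem StarRep.continuous_op {B : Type*} [NonUnitalCStarAlgebra B] (π : StarRep B H) :
    Continuous π.op :=
  AddMonoidHomClass.continuous_of_bound π.op 1 fun b => by simpa using π.norm_op_le b

variable [IsScalarTower ℂ A A] [SMulCommClass ℂ A A] [StarModule ℂ A]

/-- The vector functional of `x` has variation at most `‖x‖²` and takes the value `‖π(a)x‖²` at
`a⋆a`, so `form_le_gn` applies. -/
theorem StarRep.norm_op_le_gn {π : StarRep A H} (hπ : IsSigmaContractive π.op) (a : A) :
    ‖π.op a‖ ≤ gnSeminorm a := by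
  refine ContinuousLinearMap.opNorm_le_bound _ (gn_nonneg a) fun x => ?_
  have h := form_le_gn (π.isPositive_vectorFunctional x)
    (StarRep.weaklyContinuousOnSA_vectorFunctional hπ x) (π.norm_sq_mem_variationBounds x) a
  rw [π.vectorFunctional_star_mul_self, Complex.ofReal_re, ← mul_pow, mul_comm] at h
  exact le_of_sq_le_sq h (mul_nonneg (gn_nonneg a) (norm_nonneg x))

theorem StarRep.isSigmaContractive_comp (π₀ : StarRep (CStarEnv A) H) :
    IsSigmaContractive (π₀.comp (toCStarEnv A)).op := fun a =>
  ((π₀.norm_op_le (toCStarEnv A a)).trans_eq (norm_toCStarEnv A a)).trans (gn_le_rSigma a)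

theorem StarRep.exists_comp_eq {π : StarRep A H} (hπ : IsSigmaContractive π.op) :
    ∃ π₀ : StarRep (CStarEnv A) H, π₀.comp (toCStarEnv A) = π := by
  let F := π.op.extendOfNorm (toCStarEnv A : A →ₗ[ℂ] CStarEnv A)
  have hF : ∀ a, F (toCStarEnv A a) = π.op a :=
    LinearMap.extendOfNorm_eq (denseRange_toCStarEnv A)
      ⟨1, fun a => by
        rw [one_mul]
        exact (StarRep.norm_op_le_gn hπ a).trans_eq (norm_toCStarEnv A a).symm⟩
  -- Multiplicativity and the adjoint relation are closed conditions, inherited from `π` on the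
  -- dense image of `j`.
  have hmul : ∀ x y, F (x * y) = F x * F y := fun x y =>
    (denseRange_toCStarEnv A).induction_on₂ (p := fun x y => F (x * y) = F x * F y)
      (isClosed_eq (by fun_prop) (by fun_prop)) (fun a b => by
        rw [← map_mul, hF, hF, hF]
        exact map_mul π.starHom a b) x y
  have hinner : ∀ z (x y : H), inner ℂ (F z x) y = inner ℂ x (F (star z) y) := fun z x y =>
    (denseRange_toCStarEnv A).induction_on
      (p := fun z => inner ℂ (F z x) y = inner ℂ x (F (star z) y)) z
      (isClosed_eq (by fun_prop) (by fun_prop)) fun a => by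
        rw [← map_star, hF, hF]
        exact π.inner_left a x y
  let π₀ : StarRep (CStarEnv A) H :=
    { toFun := fun z => (F z : H →ₗ[ℂ] H)
      map_smul' := fun c z => by rw [map_smul]; rfl
      map_zero' := by rw [map_zero]; rfl
      map_add' := fun z w => by rw [map_add]; rfl
      map_mul' := fun z w => by rw [hmul]; rfl
      inner_left := hinner }
  refine ⟨π₀, StarRep.ext_toFun fun a => ?_⟩
  exact congrArg (fun T : H →L[ℂ] H => (T : H →ₗ[ℂ] H)) (hF a)

theorem StarRep.comp_toCStarEnv_injective :
    Function.Injective fun π₀ : StarRep (CStarEnv A) H => π₀.comp (toCStarEnv A) := by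
  intro π₁ π₂ h
  have h1 : (π₁.op : CStarEnv A → H →L[ℂ] H) = π₂.op :=
    (denseRange_toCStarEnv A).equalizer π₁.continuous_op π₂.continuous_op (funext fun a =>
      congrArg (fun π : StarRep A H => π.op a) h)
  exact StarRep.ext_toFun fun z => congrArg (fun T : H →L[ℂ] H => (T : H →ₗ[ℂ] H)) (congrFun h1 z)

theorem StarRep.bijOn_comp_toCStarEnv :
    Set.BijOn (fun π₀ : StarRep (CStarEnv A) H => π₀.comp (toCStarEnv A))
      Set.univ {π : StarRep A H | IsSigmaContractive π.op} :=
  ⟨fun π₀ _ => π₀.isSigmaContractive_comp, StarRep.comp_toCStarEnv_injective.injOn,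
    fun _ hπ => (StarRep.exists_comp_eq hπ).imp fun _ h => ⟨trivial, h⟩⟩

end Representations

/-! ### The weak* topology on quasi-states and states. -/

section StateSpaces

variable {A : Type u} [NonUnitalNormedRing A] [StarRing A] [NormedSpace ℂ A]
  [IsScalarTower ℂ A A] [SMulCommClass ℂ A A] [StarModule ℂ A]

theorem continuous_quasiState_iff {X : Type*} [TopologicalSpace X] {f : X → QuasiState A} :
    Continuous f ↔ ∀ h : selfAdjoint A, Continuous fun x => ((f x).1 (h : A)).re := by
  rw [continuous_induced_rng]
  exact ⟨fun hf h => (WeakDual.eval_continuous h).comp hf,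
    fun hf => WeakDual.continuous_of_continuous_eval (g := fun x => (f x).toWeakDual) hf⟩

theorem QuasiState.norm_apply_le (φ : QuasiState A) (h : selfAdjoint A) : ‖φ.1 (h : A)‖ ≤ ‖h‖ := by
  have := norm_le_of_isSelfAdjoint φ.2.positive φ.2.weaklyContinuous φ.2.one_mem h h.2
  rwa [one_mul] at this

theorem isQuasiState_pullback {φ₀ : CStarEnv A →ₗ[ℂ] ℂ} (h : IsQuasiState φ₀) :
    IsQuasiState (φ₀ ∘ₗ (toCStarEnv A : A →ₗ[ℂ] CStarEnv A)) :=
  ⟨pullback_isPositive h.positive, pullback_weaklyContinuous h.positive,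
    pullback_hasFiniteVariation h.positive,
    (pullback_variation h.positive).trans_le h.variation_le_one⟩

variable (A) in
/-- The restriction map `QS(C*(A)) → QS(A)`. -/
noncomputable def pullbackQuasiState (φ₀ : QuasiState (CStarEnv A)) : QuasiState A :=
  ⟨φ₀.1 ∘ₗ (toCStarEnv A : A →ₗ[ℂ] CStarEnv A), isQuasiState_pullback φ₀.2⟩

theorem pullbackQuasiState_bijective : Function.Bijective (pullbackQuasiState A) := by
  refine ⟨fun φ₁ φ₂ h => Subtype.ext (pullback_injOn φ₁.2.positive φ₂.2.positive
    (congrArg Subtype.val h)), fun φ => ?_⟩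
  obtain ⟨φ₀, hp, h⟩ := exists_isPositive_comp_eq φ.2.positive φ.2.finiteVariation
    φ.2.weaklyContinuous
  refine ⟨⟨φ₀, hp, hp.weaklyContinuous, hp.hasFiniteVariation, ?_⟩, Subtype.ext h⟩
  rw [← pullback_variation hp, h]
  exact φ.2.variation_le_one

theorem continuous_pullbackQuasiState : Continuous (pullbackQuasiState A) :=
  continuous_quasiState_iff.2 fun h =>
    continuous_quasiState_iff.1 continuous_id (toCStarEnvSA h)

/-- A map into `QS(C*(A))` is continuous as soon as its composition with the restriction to `A`
is: quasi-states of `C*(A)` are equicontinuous and `j(A_sa)` is dense in the self-adjoint part. -/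
theorem continuous_of_continuous_pullback {X : Type*} [TopologicalSpace X]
    {f : X → QuasiState (CStarEnv A)} (hf : Continuous fun x => pullbackQuasiState A (f x)) :
    Continuous f := by
  refine continuous_quasiState_iff.2 fun k => ?_
  refine continuous_of_uniform_approx_of_continuous fun U hU => ?_
  obtain ⟨ε, hε, hU⟩ := Metric.mem_uniformity_dist.1 hU
  obtain ⟨h, hh⟩ := Metric.mem_closure_range_iff.1 (denseRange_toCStarEnvSA k) ε hε
  -- Evaluation at `j(h)` approximates evaluation at `k` with error at most `‖k - j(h)‖ < ε`,
  -- uniformly over all quasi-states.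
  refine ⟨_, continuous_quasiState_iff.1 hf h, fun x => hU (lt_of_le_of_lt ?_ hh)⟩
  rw [Real.dist_eq, dist_eq_norm]
  refine le_trans ?_ ((f x).norm_apply_le (k - toCStarEnvSA h))
  refine le_trans (le_of_eq ?_) (Complex.abs_re_le_norm _)
  rw [AddSubgroupClass.coe_sub, map_sub, Complex.sub_re]
  rfl

variable (A) in
/-- Restriction as a homeomorphism from `QS(C*(A))` onto `QS(A)`. -/
noncomputable def quasiStateHomeomorph : QuasiState (CStarEnv A) ≃ₜ QuasiState A where
  toEquiv := Equiv.ofBijective (pullbackQuasiState A) pullbackQuasiState_bijective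
  continuous_toFun := continuous_pullbackQuasiState
  -- The inverse followed by restriction is the identity of `QS(A)`, which is continuous.
  continuous_invFun := continuous_of_continuous_pullback <|
    continuous_id.congr fun φ =>
      ((Equiv.ofBijective _ pullbackQuasiState_bijective).apply_symm_apply φ).symm

theorem mem_stateSet_iff (φ₀ : QuasiState (CStarEnv A)) :
    φ₀ ∈ stateSet (CStarEnv A) ↔ quasiStateHomeomorph A φ₀ ∈ stateSet A := by
  have hv := pullback_variation φ₀.2.positive
  exact ⟨fun h => (quasiStateHomeomorph A φ₀).2.isState (hv.trans h.variation_eq_one),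
    fun h => φ₀.2.isState (hv.symm.trans h.variation_eq_one)⟩

end StateSpaces

end EnvCStar

/-! ### The universal property. -/

open EnvCStar in
theorem mainTheorem4 (A : Type u) [NonUnitalNormedRing A] [StarRing A] [NormedSpace ℂ A]
    [IsScalarTower ℂ A A] [SMulCommClass ℂ A A] [StarModule ℂ A] :
    -- representations
    (∀ (H : Type v) [NormedAddCommGroup H] [InnerProductSpace ℂ H] [CompleteSpace H],
      Set.BijOn (fun π₀ : StarRep (CStarEnv A) H => π₀.comp (toCStarEnv A))
        Set.univ {π : StarRep A H | IsSigmaContractive π.op}) ∧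
    -- positive functionals
    (Set.BijOn
        (fun φ₀ : CStarEnv A →ₗ[ℂ] ℂ => φ₀ ∘ₗ (toCStarEnv A : A →ₗ[ℂ] CStarEnv A))
        {φ₀ | IsPositive φ₀}
        {φ : A →ₗ[ℂ] ℂ | IsPositive φ ∧ HasFiniteVariation φ ∧ WeaklyContinuousOnSA φ} ∧
      ∀ φ₀ : CStarEnv A →ₗ[ℂ] ℂ, IsPositive φ₀ →
        HasFiniteVariation φ₀ ∧
        variation (φ₀ ∘ₗ (toCStarEnv A : A →ₗ[ℂ] CStarEnv A)) = variation φ₀) ∧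
    -- quasi-states and states
    (Convex ℝ {φ₀ : CStarEnv A →ₗ[ℂ] ℂ | IsQuasiState φ₀} ∧
      Convex ℝ {φ : A →ₗ[ℂ] ℂ | IsQuasiState φ} ∧
      Convex ℝ {φ₀ : CStarEnv A →ₗ[ℂ] ℂ | IsState φ₀} ∧
      Convex ℝ {φ : A →ₗ[ℂ] ℂ | IsState φ} ∧
      ∃ Φ : QuasiState (CStarEnv A) ≃ₜ QuasiState A,
        (∀ φ₀ : QuasiState (CStarEnv A),
          (Φ φ₀).1 = φ₀.1 ∘ₗ (toCStarEnv A : A →ₗ[ℂ] CStarEnv A)) ∧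
        (∀ (φ₁ φ₂ φ₃ : QuasiState (CStarEnv A)) (s t : ℝ), 0 ≤ s → 0 ≤ t → s + t = 1 →
          φ₃.1 = s • φ₁.1 + t • φ₂.1 → (Φ φ₃).1 = s • (Φ φ₁).1 + t • (Φ φ₂).1) ∧
        ∃ Ψ : stateSet (CStarEnv A) ≃ₜ stateSet A,
          ∀ ψ₀ : stateSet (CStarEnv A), (Ψ ψ₀ : QuasiState A) = Φ ψ₀) := by
  refine ⟨fun H _ _ _ => StarRep.bijOn_comp_toCStarEnv,
    ⟨bijOn_positive A, fun φ₀ hp => ⟨hp.hasFiniteVariation, pullback_variation hp⟩⟩,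
    convex_isQuasiState _, convex_isQuasiState A,
    fun φ₁ h₁ φ₂ h₂ s t hs ht hst => isState_convexComb h₁ h₂ hs ht hst, convex_isState A,
    quasiStateHomeomorph A, fun _ => rfl, fun φ₁ φ₂ φ₃ s t _ _ _ h => ?_,
    (quasiStateHomeomorph A).subtype mem_stateSet_iff, fun _ => rfl⟩
  change φ₃.1 ∘ₗ (toCStarEnv A : A →ₗ[ℂ] CStarEnv A) = _
  rw [h]
  rfl
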